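/- Let $n\ge 0$, let $S_n$ be the symmetric group with simple transpositions $s_i=(i\ i{+}1)$, $1\le i\le n-1$, and Coxeter length $\ell$, let $w_0=n(n-1)\cdots 1$ (one-line notation) be its longest element and $N=\binom n2$. For a word $R=i_1\cdots i_L$ in $\{1,\dots,n-1\}$ put $w(R)=s_{i_1}\cdots s_{i_L}$; $\operatorname{Red}(w_0)$ is the set of words $R$ with $w(R)=w_0$ and $L=\ell(w_0)$. Write $\operatorname{pos}_x(t)=x^{-1}(t)$. *Weights.* For a set $A\subseteq\{1,\dots,L\}$ of positions let $x_0=e$, and for $k\geq 1$ let $x_k=x_{k-1}s_{i_k}$ if $k\in A$ and $x_k=x_{k-1}$ otherwise. Call $k$ good if [$k\in A$ if and only if $\ell(x_{k-1}s_{i_k})>\ell(x_{k-1})$], and let $d(A)$ be the number of good $k$. Put $$\operatorname{wt}_R(x)=\sum_{A:\ x_L=x}q^{d(A)}\in\mathbb Z[q],\qquad D_R(x)=[q^{N-1}]\operatorname{wt}_R(x)$$ (with $N-1$ read as $0$ when $N=0$). *The signed interval statistic.* Let $\operatorname{Supp}(x)=\{t:\operatorname{pos}_x(t)\ne\operatorname{pos}_{w_0}(t)\}$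 and $\sigma_b(x)=\operatorname{sgn}(\operatorname{pos}_x(b)-\operatorname{pos}_{w_0}(b))$. For $1\le a<b<c\le n$ put $$\Theta_R(a,b,c)=\sum_{x\in S_n:\ \operatorname{Supp}(x)=\{a,a+1,\dots,c\}}D_R(x)\,\sigma_b(x).$$ *The triple invariant.* For $R\in\operatorname{Red}(w_0)$ and $a<b$ let $\tau_R(a,b)$ be the least $t$ such that the values $a,b$ are inverted in $s_{i_1}\cdots s_{i_t}$, that is, $b$ stands to the left of $a$ in its one-line notation. For $a<b<c$ let $T_R(a,b,c)=1$ if $\tau_R(a,b)<\tau_R(b,c)$, and $T_R(a,b,c)=-1$ otherwise. *Demazure product.* $\operatorname{Dem}(R)=e*s_{i_1}*\cdots*s_{i_L}$, where $w*s_i=ws_i$ if $\ell(ws_i)>\ell(w)$ and $w*s_i=w$ otherwise. Then: 1. There are constants $C(a,b,c)$, independent of $R$, with $\Theta_R(a,b,c)+T_R(a,b,c)=C(a,b,c)$ for all $R\in\operatorname{Red}(w_0)$ and all $a<b<c$, and $C(a,b,c)=0$. 2. Equivalently, $\Theta_R(a,b,c)=-T_R(a,b,c)$ for all $R\in\operatorname{Red}(w_0)$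 and all $a<b<c$. 3. Consequently $\Theta_R$ recovers the commutation class: for $R_1,R_2\in\operatorname{Red}(w_0)$ one has $\Theta_{R_1}(a,b,c)=\Theta_{R_2}(a,b,c)$ for all $a<b<c$ if and only if $R_1$ and $R_2$ are connected by a finite sequence of commutation moves (replacing a consecutive factor $ij$ with $|i-j|>1$ by $ji$). 4. The coefficients $D_R$ count one-letter Demazure shortenings: if $n\ge2$, then for all $R=i_1\cdots i_N\in\operatorname{Red}(w_0)$ and $x\in S_n$, $$D_R(x)=\#\{j\in\{1,\dots,N\}:\operatorname{Dem}(i_1\cdots\widehat{i_j}\cdots i_N)=x\}.$$ -/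

import Mathlib

namespace BottSamelsonWords

/-- Words in the alphabet `{1, …, n-1}`; the element `i : Fin (n - 1)` stands for the letter
`i + 1`. -/
abbrev Word (n : ℕ) : Type := List (Fin (n - 1))

/-- The simple transposition `(i, i+1)` of `S_n`, the symmetric group on `Fin n`
(with `Fin n` standing for `{1, …, n}`). -/
def simpleRefl {n : ℕ} (i : Fin (n - 1)) : Equiv.Perm (Fin n) :=
  Equiv.swap ⟨i.val, by omega⟩ ⟨i.val + 1, by omega⟩

/-- The ordinary product `w(R) = s_{i_1} s_{i_2} ⋯ s_{i_L}` of a word. -/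
def wordProd {n : ℕ} (R : Word n) : Equiv.Perm (Fin n) :=
  (R.map simpleRefl).prod

/-- Coxeter length: the least length of a word in the simple transpositions representing `w`. -/
noncomputable def coxLength {n : ℕ} (w : Equiv.Perm (Fin n)) : ℕ :=
  sInf {k : ℕ | ∃ R : Word n, R.length = k ∧ wordProd R = w}

/-- `Red(w)`, the set of reduced words for `w`. -/
def reducedWords {n : ℕ} (w : Equiv.Perm (Fin n)) : Set (Word n) :=
  {R | wordProd R = w ∧ R.length = coxLength w}

/-- The longest element `w₀ = n (n-1) ⋯ 2 1` in one-line notation. -/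
def longest (n : ℕ) : Equiv.Perm (Fin n) := Fin.revPerm

/-! ### Commutation classes -/

/-- A single commutation move: a factor `i j` with `|i - j| > 1` is replaced by `j i`. -/
def CommMove {n : ℕ} (R R' : Word n) : Prop :=
  ∃ (T₁ T₂ : Word n) (i j : Fin (n - 1)), (i.val + 1 < j.val ∨ j.val + 1 < i.val) ∧
    R = T₁ ++ i :: j :: T₂ ∧ R' = T₁ ++ j :: i :: T₂

/-- Two words lie in the same commutation class if they are connected by finitely many
commutation moves. -/
def SameCommClass {n : ℕ} (R R' : Word n) : Prop := Relation.ReflTransGen CommMove R R'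

/-! ### The triple invariant `T_R` -/

/-- The position of the value `t` in the one-line notation of `x`. -/
def pos {n : ℕ} (x : Equiv.Perm (Fin n)) (t : Fin n) : Fin n := x⁻¹ t

/-- `τ_R(a, b)` for `a < b`: the first time at which the pair of values `(a, b)` is inverted,
when the letters of `R` are applied successively to the identity. -/
noncomputable def tau {n : ℕ} (R : Word n) (a b : Fin n) : ℕ :=
  sInf {t : ℕ | pos (wordProd (R.take t)) b < pos (wordProd (R.take t)) a}

/-- The commutation-class invariant `T_R(a, b, c) ∈ {1, -1}`. -/
noncomputable def tripleInv {n : ℕ} (R : Word n) (a b c : Fin n) : ℤ :=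
  if tau R a b < tau R b c then 1 else -1

/-! ### Weighted subwords -/

/-- The word obtained from `R` by selecting the letters in the set `S` of positions. -/
def subword {n : ℕ} (R : Word n) (S : Finset (Fin R.length)) : Word n :=
  ((List.finRange R.length).filter (fun k => k ∈ S)).map R.get

/-- The pair `(x_k, d_k)` after the first `k` letters of `R` have been read, when the positions
in `S` are selected. The decision at a position is good if the letter is selected exactly when
multiplying by it increases the length; `d_k` counts the good decisions so far. -/
noncomputable def walk {n : ℕ} (R : Word n) (S : Finset (Fin R.length)) :
    ℕ → Equiv.Perm (Fin n) × ℕ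
  | 0 => (1, 0)
  | k + 1 =>
    if h : k < R.length then
      let x := (walk R S k).1
      let d := (walk R S k).2
      let s := simpleRefl (R.get ⟨k, h⟩)
      (if (⟨k, h⟩ : Fin R.length) ∈ S then x * s else x,
        if ((⟨k, h⟩ : Fin R.length) ∈ S ↔ coxLength x < coxLength (x * s)) then d + 1 else d)
    else walk R S k

/-- The weight `wt_R(x) ∈ ℤ[q]`: the sum of `q ^ d_L` over all subwords (position sets) of `R`
whose ordinary product is `x`. -/
noncomputable def wt {n : ℕ} (R : Word n) (x : Equiv.Perm (Fin n)) : Polynomial ℤ :=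
  ∑ S : Finset (Fin R.length) with wordProd (subword R S) = x,
    (Polynomial.X : Polynomial ℤ) ^ (walk R S R.length).2

/-- `D_R(x)`, the coefficient of `q ^ (N - 1)` in `wt_R(x)`, where `N = n.choose 2`. -/
noncomputable def secondCoeff {n : ℕ} (R : Word n) (x : Equiv.Perm (Fin n)) : ℤ :=
  (wt R x).coeff (n.choose 2 - 1)

/-! ### Demazure products -/

/-- The elementary Demazure product `w * s_i`. -/
noncomputable def demMul {n : ℕ} (w : Equiv.Perm (Fin n)) (i : Fin (n - 1)) :
    Equiv.Perm (Fin n) :=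
  if coxLength w < coxLength (w * simpleRefl i) then w * simpleRefl i else w

/-- The Demazure product `Dem(R) = e * s_{i_1} * ⋯ * s_{i_L}` of a word. -/
noncomputable def dem {n : ℕ} (R : Word n) : Equiv.Perm (Fin n) := R.foldl demMul 1

/-! ### The signed interval statistic -/

/-- `Supp(x)`: the values whose position in `x` differs from their position in `w₀`. -/
def supp {n : ℕ} (x : Equiv.Perm (Fin n)) : Finset (Fin n) :=
  {t | pos x t ≠ pos (longest n) t}

/-- `σ_b(x) = sgn (pos_x(b) - pos_{w₀}(b))`. -/
def sigma {n : ℕ} (b : Fin n) (x : Equiv.Perm (Fin n)) : ℤ :=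
  Int.sign (((pos x b).val : ℤ) - ((pos (longest n) b).val : ℤ))

/-- `Θ_R(a, b, c)`: the sum of `D_R(x) σ_b(x)` over all `x` with `Supp(x) = [a, c]`. -/
noncomputable def Theta {n : ℕ} (R : Word n) (a b c : Fin n) : ℤ :=
  ∑ x : Equiv.Perm (Fin n) with supp x = Finset.Icc a c, secondCoeff R x * sigma b x

end BottSamelsonWords

open BottSamelsonWords

/-! A subword is determined by its set of bad decisions, every set of positions occurs, and the
exponent is the length minus the number of bad decisions. So `secondCoeff` counts walks with a
single bad decision. Up to it the walk follows a reduced prefix, where every letter is an ascent, so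
the bad decision is an omission; afterwards good decisions are Demazure multiplications. This is
`secondCoeff_eq_card`.

Now omit the letter exchanging adjacent values a < c. For each threshold k, compare the positions of
the values at least k in the true prefix p and in the defective permutation z. A Demazure step sorts
two adjacent entries, hence acts on these sets for each k separately. Thresholds outside (a, c]
never see the omission; for the others z lacks the position of one value h ≥ k of p and gains that
of one value g < k (`Defect`). At the end g is the largest value below k among a and the
intermediate values that stood right of the pair; h is the smallest value at least k among c and
those that stood left. Comparing thresholds b and b + 1 shows that the support is [a, c] and that b
moves right exactly when it stood right of the pair (`displacement_of_defect`).

Each pair is exchanged exactly once, so one omission contributes to Θ(a, b, c), and b stands left of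
the pair at that moment exactly when T = 1. Hence Θ = -T. Finally T determines the commutation
class: after a common prefix, the next letter of one word can be commuted to the front of the rest
of the other (`far_of_leadsAt_iff`). -/

namespace BottSamelsonWords

/-! ### Simple transpositions and positions of values -/

/-- The left position moved by the `i`-th simple transposition. -/
def leftPos {n : ℕ} (i : Fin (n - 1)) : Fin n := ⟨i.val, by omega⟩

/-- The right position moved by the `i`-th simple transposition. -/
def rightPos {n : ℕ} (i : Fin (n - 1)) : Fin n := ⟨i.val + 1, by omega⟩

theorem leftPos_lt_rightPos {n : ℕ} (i : Fin (n - 1)) : leftPos i < rightPos i := by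
  simp [leftPos, rightPos, Fin.lt_def]

theorem simpleRefl_val {n : ℕ} (i : Fin (n - 1)) (j : Fin n) :
    (simpleRefl i j).val =
      if j.val = i.val then i.val + 1 else if j.val = i.val + 1 then i.val else j.val := by
  unfold simpleRefl
  rw [Equiv.swap_apply_def]
  simp only [Fin.ext_iff]
  split_ifs <;> simp

@[simp] theorem simpleRefl_leftPos {n : ℕ} (i : Fin (n - 1)) :
    simpleRefl i (leftPos i) = rightPos i := Equiv.swap_apply_left _ _

@[simp] theorem simpleRefl_rightPos {n : ℕ} (i : Fin (n - 1)) :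
    simpleRefl i (rightPos i) = leftPos i := Equiv.swap_apply_right _ _

theorem simpleRefl_of_ne {n : ℕ} {i : Fin (n - 1)} {j : Fin n} (h₁ : j ≠ leftPos i)
    (h₂ : j ≠ rightPos i) : simpleRefl i j = j := Equiv.swap_apply_of_ne_of_ne h₁ h₂

@[simp] theorem simpleRefl_mul_self {n : ℕ} (i : Fin (n - 1)) :
    simpleRefl i * simpleRefl i = 1 := Equiv.swap_mul_self _ _

theorem pos_mul_simpleRefl {n : ℕ} (p : Equiv.Perm (Fin n)) (i : Fin (n - 1)) (t : Fin n) :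
    pos (p * simpleRefl i) t = simpleRefl i (pos p t) := by
  simp only [pos, mul_inv_rev, Equiv.Perm.mul_apply]
  congr 1

@[simp] theorem pos_apply {n : ℕ} (p : Equiv.Perm (Fin n)) (j : Fin n) : pos p (p j) = j := by
  simp [pos]

@[simp] theorem apply_pos {n : ℕ} (p : Equiv.Perm (Fin n)) (t : Fin n) : p (pos p t) = t := by
  simp [pos]

theorem pos_injective {n : ℕ} (p : Equiv.Perm (Fin n)) : Function.Injective (pos p) :=
  (p⁻¹).injective

theorem pos_eq_iff {n : ℕ} {p : Equiv.Perm (Fin n)} {t j : Fin n} : pos p t = j ↔ t = p j := by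
  constructor
  · rintro rfl; simp
  · rintro rfl; simp

@[simp] theorem wordProd_append {n : ℕ} (U V : Word n) :
    wordProd (U ++ V) = wordProd U * wordProd V := by
  simp [wordProd]

@[simp] theorem wordProd_cons {n : ℕ} (i : Fin (n - 1)) (V : Word n) :
    wordProd (i :: V) = simpleRefl i * wordProd V := by
  simp [wordProd]

@[simp] theorem wordProd_nil {n : ℕ} : wordProd ([] : Word n) = 1 := rfl

/-! ### Inversion sets and Coxeter length -/

/-- The set of pairs of values that stand in the wrong order in the one-line notation. -/
def invs {n : ℕ} (p : Equiv.Perm (Fin n)) : Finset (Fin n × Fin n) :=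
  {ab | ab.1 < ab.2 ∧ pos p ab.2 < pos p ab.1}

theorem mem_invs {n : ℕ} {p : Equiv.Perm (Fin n)} {a b : Fin n} :
    (a, b) ∈ invs p ↔ a < b ∧ pos p b < pos p a := by simp [invs]

@[simp] theorem invs_one {n : ℕ} : invs (1 : Equiv.Perm (Fin n)) = ∅ := by
  ext ⟨a, b⟩
  simp only [mem_invs, pos, inv_one, Equiv.Perm.one_apply, Finset.notMem_empty, iff_false]
  intro h
  exact lt_asymm h.1 h.2

theorem notMem_invs_of_ascent {n : ℕ} {p : Equiv.Perm (Fin n)} {i : Fin (n - 1)} :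
    (p (leftPos i), p (rightPos i)) ∉ invs p := by
  simp only [mem_invs, pos_apply, not_and, not_lt]
  intro _
  exact (leftPos_lt_rightPos i).le

theorem invs_mul_of_ascent {n : ℕ} {p : Equiv.Perm (Fin n)} {i : Fin (n - 1)}
    (h : p (leftPos i) < p (rightPos i)) :
    invs (p * simpleRefl i) = insert (p (leftPos i), p (rightPos i)) (invs p) := by
  ext ⟨a, b⟩
  obtain ⟨α, rfl⟩ := p.surjective a
  obtain ⟨β, rfl⟩ := p.surjective b
  simp only [mem_invs, Finset.mem_insert, pos_mul_simpleRefl, pos_apply, Prod.mk.injEq,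
    p.injective.eq_iff]
  by_cases h1 : α = leftPos i
  · by_cases h2 : β = rightPos i
    · subst h1 h2
      simp [h, leftPos_lt_rightPos]
    · simp only [h2, and_false, false_or, and_congr_right_iff]
      intro _
      simp only [leftPos, rightPos, Fin.ext_iff] at h1 h2
      simp only [Fin.lt_def, simpleRefl_val]
      split_ifs <;> omega
  · simp only [h1, false_and, false_or, and_congr_right_iff]
    intro h3
    by_cases h2 : α = rightPos i ∧ β = leftPos i
    · rw [h2.1, h2.2] at h3
      exact absurd h3 (lt_asymm h)
    · simp only [leftPos, rightPos, Fin.ext_iff] at h1 h2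
      simp only [Fin.lt_def, simpleRefl_val]
      split_ifs <;> omega

theorem card_invs_mul_of_ascent {n : ℕ} {p : Equiv.Perm (Fin n)} {i : Fin (n - 1)}
    (h : p (leftPos i) < p (rightPos i)) :
    (invs (p * simpleRefl i)).card = (invs p).card + 1 := by
  rw [invs_mul_of_ascent h, Finset.card_insert_of_notMem notMem_invs_of_ascent]

theorem card_invs_mul_of_descent {n : ℕ} {p : Equiv.Perm (Fin n)} {i : Fin (n - 1)}
    (h : p (rightPos i) < p (leftPos i)) :
    (invs (p * simpleRefl i)).card + 1 = (invs p).card := by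
  have := card_invs_mul_of_ascent (p := p * simpleRefl i) (i := i) (by simpa using h)
  rw [mul_assoc, simpleRefl_mul_self, mul_one] at this
  exact this.symm

theorem apply_leftPos_ne {n : ℕ} (p : Equiv.Perm (Fin n)) (i : Fin (n - 1)) :
    p (leftPos i) ≠ p (rightPos i) :=
  fun h => (leftPos_lt_rightPos i).ne (p.injective h)

/-- Each letter changes the number of inversions by exactly one. With p = 1 this is the lower bound
on the length of a word. -/
theorem card_invs_mul_wordProd_le {n : ℕ} (V : Word n) (p : Equiv.Perm (Fin n)) :
    (invs (p * wordProd V)).card ≤ (invs p).card + V.length := by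
  induction V generalizing p with
  | nil => simp
  | cons i V ih =>
    rw [wordProd_cons, ← mul_assoc, List.length_cons]
    refine (ih _).trans ?_
    rcases lt_or_gt_of_ne (apply_leftPos_ne p i) with h | h
    · rw [card_invs_mul_of_ascent h]; omega
    · have := card_invs_mul_of_descent h; omega

theorem exists_descent {n : ℕ} {p : Equiv.Perm (Fin n)} (hp : p ≠ 1) :
    ∃ i : Fin (n - 1), p (rightPos i) < p (leftPos i) := by
  by_contra! hcon
  apply hp
  cases n with
  | zero => exact Subsingleton.elim _ _
  | succ n =>
    have hmono : StrictMono p := by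
      rw [Fin.strictMono_iff_lt_succ]
      intro i
      exact lt_of_le_of_ne (hcon i) (apply_leftPos_ne p i)
    ext1 t
    have : (p : Fin (n + 1) → Fin (n + 1)) = id := by
      -- Without descents the one-line notation increases, and the identity is the only increasing
      -- map with full range.
      refine (StrictMono.range_inj hmono strictMono_id).1 ?_
      simp [p.surjective.range_eq]
    simpa using congrFun this t

theorem exists_word_card_invs {n : ℕ} (m : ℕ) (p : Equiv.Perm (Fin n)) (hm : (invs p).card = m) :
    ∃ R : Word n, R.length = m ∧ wordProd R = p := by
  induction m generalizing p with
  | zero =>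
    refine ⟨[], rfl, ?_⟩
    by_contra hp
    obtain ⟨i, hi⟩ := exists_descent (Ne.symm hp)
    have := card_invs_mul_of_descent hi
    omega
  | succ m ih =>
    have hp : p ≠ 1 := by
      rintro rfl
      simp at hm
    obtain ⟨i, hi⟩ := exists_descent hp
    obtain ⟨R, hR, hRp⟩ := ih (p * simpleRefl i) (by have := card_invs_mul_of_descent hi; omega)
    refine ⟨R ++ [i], by simp [hR], ?_⟩
    rw [wordProd_append, hRp]
    simp [mul_assoc]

theorem coxLength_eq_card_invs {n : ℕ} (p : Equiv.Perm (Fin n)) :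
    coxLength p = (invs p).card := by
  refine IsLeast.csInf_eq ⟨exists_word_card_invs _ p rfl, ?_⟩
  rintro k ⟨R, rfl, rfl⟩
  simpa using card_invs_mul_wordProd_le R 1

theorem coxLength_lt_iff {n : ℕ} {p : Equiv.Perm (Fin n)} {i : Fin (n - 1)} :
    coxLength p < coxLength (p * simpleRefl i) ↔ p (leftPos i) < p (rightPos i) := by
  rw [coxLength_eq_card_invs, coxLength_eq_card_invs]
  rcases lt_or_gt_of_ne (apply_leftPos_ne p i) with h | h
  · simp [card_invs_mul_of_ascent h, h]
  · have := card_invs_mul_of_descent h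
    simp only [h.asymm, iff_false]
    omega

/-! ### The longest element and prefixes of its reduced words -/

theorem pos_longest {n : ℕ} (t : Fin n) : pos (longest n) t = t.rev := rfl

theorem longest_apply {n : ℕ} (t : Fin n) : longest n t = t.rev := rfl

theorem mem_invs_longest {n : ℕ} {a b : Fin n} : (a, b) ∈ invs (longest n) ↔ a < b := by
  simp [mem_invs, pos_longest, Fin.rev_lt_rev]

theorem card_invs_longest (n : ℕ) : (invs (longest n)).card = n.choose 2 := by
  have : invs (longest n) = Finset.univ.filter fun ab : Fin n × Fin n => ab.1 < ab.2 := by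
    ext ⟨a, b⟩
    simp [mem_invs_longest]
  rw [this]
  have h2 : (Finset.univ.filter fun ab : Fin n × Fin n => ab.1 < ab.2).card =
      ∑ b : Fin n, b.val := by
    -- Pairs are counted by their larger element b, which has b smaller partners.
    rw [Finset.card_eq_sum_card_fiberwise (f := Prod.snd) (t := Finset.univ) (by simp)]
    refine Finset.sum_congr rfl fun b _ => ?_
    rw [← Fin.card_Iio b]
    refine Finset.card_bij (fun ab _ => ab.1) ?_ ?_ ?_
    · rintro ⟨a, c⟩ h
      simp only [Finset.mem_filter, Finset.mem_univ, true_and] at h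
      rw [Finset.mem_Iio, ← h.2]
      exact h.1
    · rintro ⟨a, c⟩ h ⟨a', c'⟩ h' heq
      simp only [Finset.mem_filter, Finset.mem_univ, true_and] at h h'
      exact Prod.ext heq (h.2.trans h'.2.symm)
    · intro a ha
      exact ⟨(a, b), by simpa using ha, rfl⟩
  rw [h2, Fin.sum_univ_eq_sum_range (fun k => k) n, Finset.sum_range_id, Nat.choose_two_right]

theorem length_of_reduced {n : ℕ} {R : Word n} (hR : R ∈ reducedWords (longest n)) :
    R.length = n.choose 2 := by
  rw [hR.2, coxLength_eq_card_invs, card_invs_longest]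

/-- A descent would remove an inversion, and the remaining letters are too few to make up for the
loss. -/
theorem ascent_of_reduced_append {n : ℕ} {U V : Word n} {i : Fin (n - 1)}
    (hR : U ++ i :: V ∈ reducedWords (longest n)) :
    wordProd U (leftPos i) < wordProd U (rightPos i) := by
  rcases lt_or_gt_of_ne (apply_leftPos_ne (wordProd U) i) with h | h
  · exact h
  · exfalso
    have h1 := card_invs_mul_of_descent h
    have h2 := card_invs_mul_wordProd_le U 1
    have h3 := card_invs_mul_wordProd_le V (wordProd U * simpleRefl i)
    have h4 := hR.2
    rw [coxLength_eq_card_invs, ← hR.1] at h4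
    simp only [wordProd_append, wordProd_cons, List.length_append, List.length_cons,
      ← mul_assoc] at h4
    simp only [one_mul, invs_one, Finset.card_empty] at h2
    omega

theorem ascent_of_reduced {n : ℕ} {R : Word n} (hR : R ∈ reducedWords (longest n)) {k : ℕ}
    (hk : k < R.length) :
    wordProd (R.take k) (leftPos R[k]) < wordProd (R.take k) (rightPos R[k]) := by
  apply ascent_of_reduced_append (V := R.drop (k + 1))
  rwa [← List.drop_eq_getElem_cons hk, List.take_append_drop]

theorem wordProd_take_succ {n : ℕ} {R : Word n} {k : ℕ} (hk : k < R.length) :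
    wordProd (R.take (k + 1)) = wordProd (R.take k) * simpleRefl R[k] := by
  rw [List.take_succ_eq_append_getElem hk, wordProd_append, wordProd_cons, wordProd_nil, mul_one]

theorem invs_take_succ {n : ℕ} {R : Word n} (hR : R ∈ reducedWords (longest n)) {k : ℕ}
    (hk : k < R.length) :
    invs (wordProd (R.take (k + 1))) =
      insert (wordProd (R.take k) (leftPos R[k]), wordProd (R.take k) (rightPos R[k]))
        (invs (wordProd (R.take k))) := by
  rw [wordProd_take_succ hk, invs_mul_of_ascent (ascent_of_reduced hR hk)]

theorem invs_take_mono {n : ℕ} {R : Word n} (hR : R ∈ reducedWords (longest n)) :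
    Monotone fun k => invs (wordProd (R.take k)) := by
  refine monotone_nat_of_le_succ fun k => ?_
  by_cases hk : k < R.length
  · simp only [invs_take_succ hR hk]
    exact Finset.subset_insert _ _
  · rw [List.take_of_length_le (by omega), List.take_of_length_le (by omega)]

/-! ### Weighted subwords and Demazure shortenings -/

theorem demMul_eq {n : ℕ} (z : Equiv.Perm (Fin n)) (i : Fin (n - 1)) :
    demMul z i = if z (leftPos i) < z (rightPos i) then z * simpleRefl i else z := by
  unfold demMul
  simp only [coxLength_lt_iff]

theorem walk_succ {n : ℕ} (R : Word n) (S : Finset (Fin R.length)) {k : ℕ} (h : k < R.length) :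
    walk R S (k + 1) =
      (if (⟨k, h⟩ : Fin R.length) ∈ S then (walk R S k).1 * simpleRefl R[k] else (walk R S k).1,
        if ((⟨k, h⟩ : Fin R.length) ∈ S ↔
          coxLength (walk R S k).1 < coxLength ((walk R S k).1 * simpleRefl R[k]))
        then (walk R S k).2 + 1 else (walk R S k).2) := by
  rw [walk, dif_pos h]
  rfl

theorem walk_fst {n : ℕ} (R : Word n) (S : Finset (Fin R.length)) {k : ℕ} (hk : k ≤ R.length) :
    (walk R S k).1 =
      wordProd ((((List.finRange R.length).take k).filter (fun k => k ∈ S)).map R.get) := by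
  induction k with
  | zero => simp [walk]
  | succ k ih =>
    have h : k < R.length := hk
    rw [walk_succ R S h, List.take_succ_eq_append_getElem (by simpa using h)]
    simp only [List.filter_append, List.map_append, wordProd_append, ← ih h.le]
    by_cases hS : (⟨k, h⟩ : Fin R.length) ∈ S <;> simp [hS]

theorem walk_length_fst {n : ℕ} (R : Word n) (S : Finset (Fin R.length)) :
    (walk R S R.length).1 = wordProd (subword R S) := by
  rw [walk_fst R S le_rfl, subword, List.take_of_length_le (by simp)]

/-- The set of positions at which the decision of the subword `S` is not good. -/
noncomputable def badSet {n : ℕ} (R : Word n) (S : Finset (Fin R.length)) :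
    Finset (Fin R.length) :=
  {k | ¬(k ∈ S ↔
    coxLength (walk R S k).1 < coxLength ((walk R S k).1 * simpleRefl R[k.val]))}

theorem mem_badSet {n : ℕ} {R : Word n} {S : Finset (Fin R.length)} {k : ℕ} (h : k < R.length) :
    (⟨k, h⟩ : Fin R.length) ∈ badSet R S ↔ ¬((⟨k, h⟩ : Fin R.length) ∈ S ↔
      coxLength (walk R S k).1 < coxLength ((walk R S k).1 * simpleRefl R[k])) := by
  simp [badSet]

theorem walk_snd {n : ℕ} (R : Word n) (S : Finset (Fin R.length)) {k : ℕ} (hk : k ≤ R.length) :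
    (walk R S k).2 + {j ∈ badSet R S | j.val < k}.card = k := by
  induction k with
  | zero => simp [walk]
  | succ k ih =>
    have h : k < R.length := hk
    specialize ih h.le
    rw [walk_succ R S h]
    by_cases hb : (⟨k, h⟩ : Fin R.length) ∈ badSet R S
    · have : {j ∈ badSet R S | j.val < k + 1} =
          insert ⟨k, h⟩ {j ∈ badSet R S | j.val < k} := by
        ext j
        simp only [Finset.mem_filter, Finset.mem_insert, Fin.ext_iff]
        constructor
        · rintro ⟨h1, h2⟩
          by_cases hj : j.val = k
          · exact Or.inl hj
          · exact Or.inr ⟨h1, by omega⟩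
        · rintro (h1 | h1)
          · exact ⟨by convert hb, by omega⟩
          · exact ⟨h1.1, by omega⟩
      rw [this, Finset.card_insert_of_notMem (by simp), if_neg ((mem_badSet h).1 hb)]
      omega
    · have : {j ∈ badSet R S | j.val < k + 1} = {j ∈ badSet R S | j.val < k} := by
        ext j
        simp only [Finset.mem_filter, and_congr_right_iff]
        intro h1
        have : j.val ≠ k := fun hj => hb (by convert h1; exact hj.symm)
        omega
      rw [mem_badSet h, not_not] at hb
      rw [this, if_pos hb]
      omega

theorem walk_length_snd {n : ℕ} (R : Word n) (S : Finset (Fin R.length)) :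
    (walk R S R.length).2 + (badSet R S).card = R.length := by
  have := walk_snd R S le_rfl
  rwa [Finset.filter_true_of_mem fun j _ => j.isLt] at this

/-- The current permutation together with the goodness of a decision determines the decision, so the
walk can be reconstructed letter by letter. By finiteness `badSet` is then a bijection. -/
theorem badSet_injective {n : ℕ} (R : Word n) : Function.Injective (badSet R) := by
  intro S S' hSS
  have key : ∀ k, k ≤ R.length → (walk R S k).1 = (walk R S' k).1 ∧
      ∀ j : Fin R.length, j.val < k → (j ∈ S ↔ j ∈ S') := by
    intro k
    induction k with
    | zero => simp [walk]
    | succ k ih =>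
      intro h
      obtain ⟨ih1, ih2⟩ := ih (by omega)
      have h' : k < R.length := h
      have hk : (⟨k, h'⟩ : Fin R.length) ∈ S ↔ (⟨k, h'⟩ : Fin R.length) ∈ S' := by
        have h1 := mem_badSet (S := S) h'
        have h2 := mem_badSet (S := S') h'
        rw [hSS, h2, ih1] at h1
        tauto
      refine ⟨?_, fun j hj => ?_⟩
      · rw [walk_succ R S h', walk_succ R S' h']
        simp only [hk, ih1]
      · by_cases hjk : j.val = k
        · convert hk
        · exact ih2 j (by omega)
  ext j
  exact (key R.length le_rfl).2 j j.isLt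

theorem dem_concat {n : ℕ} (U : Word n) (i : Fin (n - 1)) :
    dem (U ++ [i]) = demMul (dem U) i := by
  simp [dem]

theorem dem_take_of_reduced {n : ℕ} {R : Word n} (hR : R ∈ reducedWords (longest n)) {k : ℕ}
    (hk : k ≤ R.length) : dem (R.take k) = wordProd (R.take k) := by
  induction k with
  | zero => simp [dem]
  | succ k ih =>
    rw [wordProd_take_succ hk, List.take_succ_eq_append_getElem hk, dem_concat, ih (by omega),
      demMul_eq, if_pos (ascent_of_reduced hR hk)]

theorem walk_of_notMem_badSet {n : ℕ} {R : Word n} {S : Finset (Fin R.length)} {k : ℕ}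
    (h : k < R.length) (hb : (⟨k, h⟩ : Fin R.length) ∉ badSet R S) :
    (walk R S (k + 1)).1 = demMul (walk R S k).1 R[k] := by
  rw [mem_badSet, not_not] at hb
  rw [walk_succ R S h]
  simp only [hb, demMul]

/-- Good decisions are Demazure multiplications, so only the letter at `j` needs an argument: it is
an ascent of the reduced prefix, so a bad decision there skips it. -/
theorem walk_of_badSet_eq_singleton {n : ℕ} {R : Word n} (hR : R ∈ reducedWords (longest n))
    {S : Finset (Fin R.length)} {j : Fin R.length} (hS : badSet R S = {j}) :
    (walk R S R.length).1 = dem (R.eraseIdx j) := by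
  have h1 : ∀ k, k ≤ j.val → (walk R S k).1 = dem (R.take k) := by
    intro k
    induction k with
    | zero => simp [walk, dem]
    | succ k ih =>
      intro hk
      have h : k < R.length := by omega
      rw [walk_of_notMem_badSet h (by simp [hS, Fin.ext_iff]; omega), ih (by omega),
        List.take_succ_eq_append_getElem h, dem_concat]
  have h2 : ∀ k, k ≤ R.length → j.val < k → (walk R S k).1 = dem ((R.take k).eraseIdx j) := by
    intro k
    induction k with
    | zero => simp
    | succ k ih =>
      intro h hj
      have h : k < R.length := h
      rw [List.take_succ_eq_append_getElem h]
      by_cases hjk : j.val = k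
      · have hb : (⟨k, h⟩ : Fin R.length) ∈ badSet R S := by simp [hS, Fin.ext_iff, hjk]
        rw [mem_badSet, coxLength_lt_iff, h1 k hjk.ge, dem_take_of_reduced hR h.le] at hb
        have hb' : (⟨k, h⟩ : Fin R.length) ∉ S := by
          have := ascent_of_reduced hR h
          tauto
        rw [walk_succ R S h]
        simp only [hb', if_false]
        rw [h1 k hjk.ge, hjk, List.eraseIdx_append_of_length_le (by simp)]
        simp [h.le]
      · rw [walk_of_notMem_badSet h (by simp [hS, Fin.ext_iff]; omega), ih h.le (by omega),
          List.eraseIdx_append_of_lt_length (by simp; omega), dem_concat]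
  have := h2 R.length le_rfl j.isLt
  rwa [List.take_length] at this

theorem secondCoeff_eq_card {n : ℕ} (hn : 2 ≤ n) {R : Word n}
    (hR : R ∈ reducedWords (longest n)) (x : Equiv.Perm (Fin n)) :
    secondCoeff R x = (Finset.card {j : Fin R.length | dem (R.eraseIdx j.val) = x} : ℤ) := by
  have hlen := length_of_reduced hR
  have hpos : 0 < n.choose 2 := Nat.choose_pos hn
  have hbij : Function.Bijective (badSet R) :=
    (Finite.injective_iff_bijective).1 (badSet_injective R)
  unfold secondCoeff wt
  rw [Polynomial.finsetSum_coeff]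
  simp only [Polynomial.coeff_X_pow]
  rw [Finset.sum_boole, Finset.filter_filter]
  congr 1
  -- `f j` is the unique subword whose only bad decision is at `j`.
  choose f hf using fun j : Fin R.length => hbij.2 {j}
  symm
  refine Finset.card_bij (fun j _ => f j) ?_ ?_ ?_
  · intro j hj
    simp only [Finset.mem_filter, Finset.mem_univ, true_and] at hj ⊢
    refine ⟨?_, ?_⟩
    · rw [← walk_length_fst, walk_of_badSet_eq_singleton hR (hf j), hj]
    · have := walk_length_snd R (f j)
      rw [hf j, Finset.card_singleton] at this
      omega
  · intro j _ j' _ h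
    have := hf j
    rw [h, hf j'] at this
    exact (Finset.singleton_injective this).symm
  · intro S hS
    simp only [Finset.mem_filter, Finset.mem_univ, true_and] at hS
    have h1 := walk_length_snd R S
    obtain ⟨j, hj⟩ := Finset.card_eq_one.1 (show (badSet R S).card = 1 by omega)
    refine ⟨j, ?_, hbij.1 ((hf j).trans hj.symm)⟩
    simp only [Finset.mem_filter, Finset.mem_univ, true_and]
    rw [← walk_of_badSet_eq_singleton hR hj, walk_length_fst, hS.1]

/-! ### Threshold sets and the propagation of a defect -/

theorem demMul_leftPos {n : ℕ} (z : Equiv.Perm (Fin n)) (i : Fin (n - 1)) :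
    demMul z i (leftPos i) = max (z (leftPos i)) (z (rightPos i)) := by
  rw [demMul_eq]
  split_ifs with h
  · simp [max_eq_right h.le]
  · simp [max_eq_left (not_lt.1 h)]

theorem demMul_rightPos {n : ℕ} (z : Equiv.Perm (Fin n)) (i : Fin (n - 1)) :
    demMul z i (rightPos i) = min (z (leftPos i)) (z (rightPos i)) := by
  rw [demMul_eq]
  split_ifs with h
  · simp [min_eq_left h.le]
  · simp [min_eq_right (not_lt.1 h)]

theorem demMul_of_ne {n : ℕ} (z : Equiv.Perm (Fin n)) {i : Fin (n - 1)} {j : Fin n}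
    (h₁ : j ≠ leftPos i) (h₂ : j ≠ rightPos i) : demMul z i j = z j := by
  rw [demMul_eq]
  split_ifs with h
  · simp [simpleRefl_of_ne h₁ h₂]
  · rfl

/-- Exchanging two adjacent values does not change the order of any other pair of values. -/
theorem pos_mul_lt_iff {n : ℕ} (p : Equiv.Perm (Fin n)) (i : Fin (n - 1)) {u v : Fin n}
    (h₁ : ¬(u = p (leftPos i) ∧ v = p (rightPos i)))
    (h₂ : ¬(u = p (rightPos i) ∧ v = p (leftPos i))) :
    pos (p * simpleRefl i) u < pos (p * simpleRefl i) v ↔ pos p u < pos p v := by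
  rw [← pos_eq_iff, ← pos_eq_iff] at h₁ h₂
  rw [pos_mul_simpleRefl, pos_mul_simpleRefl]
  simp only [Fin.lt_def, simpleRefl_val, leftPos, rightPos, Fin.ext_iff] at *
  split_ifs <;> omega

/-- The set of positions of values at least `k` in `z` agrees with that in `p`. -/
def AgreesAt {n : ℕ} (k : ℕ) (p z : Equiv.Perm (Fin n)) : Prop :=
  ∀ j, k ≤ (z j).val ↔ k ≤ (p j).val

/-- At an ascent p is sorted too, and sorting commutes with passing to a threshold set. -/
theorem AgreesAt.step {n : ℕ} {k : ℕ} {p z : Equiv.Perm (Fin n)} (H : AgreesAt k p z)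
    {i : Fin (n - 1)} (hp : p (leftPos i) < p (rightPos i)) :
    AgreesAt k (p * simpleRefl i) (demMul z i) := by
  intro j
  have hl := H (leftPos i)
  have hr := H (rightPos i)
  rw [Equiv.Perm.mul_apply]
  rw [Fin.lt_def] at hp
  by_cases h1 : j = leftPos i
  · subst h1
    rw [demMul_leftPos, simpleRefl_leftPos, Fin.coe_max]
    omega
  · by_cases h2 : j = rightPos i
    · subst h2
      rw [demMul_rightPos, simpleRefl_rightPos, Fin.coe_min]
      omega
    · rw [demMul_of_ne z h1 h2, simpleRefl_of_ne h1 h2]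
      exact H j

/-- The set of positions of values at least `k` in `z` is obtained from that in `p` by removing
the position of some `h ≥ k` and adding the position of some `g < k`. The values `g` and `h` are
kept track of by their order relative to the values between `a` and `c`: among these, `r` holds
for the values to the right of the pair at the time when the defect arises. -/
structure Defect {n : ℕ} (r : Fin n → Prop) (a c : Fin n) (k : ℕ) (p z : Equiv.Perm (Fin n))
    (g h : Fin n) : Prop where
  g_lt : g.val < k
  le_h : k ≤ h.val
  le_g : a ≤ g
  h_le : h ≤ c
  pos_lt : pos p h < pos p g
  iff_of : ∀ j, k ≤ (z j).val ↔ (k ≤ (p j).val ∧ p j ≠ h) ∨ p j = g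
  g_mem : g = a ∨ r g
  h_mem : h = c ∨ ¬r h
  g_above : ∀ y, g < y → y.val < k → (r y ↔ pos p g < pos p y)
  h_below : ∀ y, y < h → k ≤ y.val → (r y ↔ pos p h < pos p y)

/-- The defect changes only when g is exchanged with a larger value below k, or h with a smaller
value at least k; that partner then takes over the role of g or h. -/
theorem Defect.step {n : ℕ} {r : Fin n → Prop} {a c : Fin n} {k : ℕ}
    {p z : Equiv.Perm (Fin n)} {g h : Fin n} (H : Defect r a c k p z g h)
    {i : Fin (n - 1)} (hp : p (leftPos i) < p (rightPos i)) :
    ∃ g' h', Defect r a c k (p * simpleRefl i) (demMul z i) g' h' := by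
  obtain ⟨H1, H2, H3, H4, H5, H6, H7, H8, H9, H10⟩ := H
  have hlr := leftPos_lt_rightPos i
  obtain ⟨x, hx⟩ : ∃ x, x = p (leftPos i) := ⟨_, rfl⟩
  obtain ⟨y, hy⟩ : ∃ y, y = p (rightPos i) := ⟨_, rfl⟩
  have hxpos : pos p x = leftPos i := pos_eq_iff.2 hx
  have hypos : pos p y = rightPos i := pos_eq_iff.2 hy
  have hxy : x < y := by rw [hx, hy]; exact hp
  have hord : ∀ u v : Fin n, ¬(u = x ∧ v = y) → ¬(u = y ∧ v = x) →
      (pos (p * simpleRefl i) u < pos (p * simpleRefl i) v ↔ pos p u < pos p v) := by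
    intro u v h1 h2
    rw [hx, hy] at h1 h2
    exact pos_mul_lt_iff p i h1 h2
  have hX : pos (p * simpleRefl i) x = rightPos i := by
    rw [pos_mul_simpleRefl, hxpos, simpleRefl_leftPos]
  have hY : pos (p * simpleRefl i) y = leftPos i := by
    rw [pos_mul_simpleRefl, hypos, simpleRefl_rightPos]
  -- The defect cannot cancel: h already stands left of g.
  have hgh : ¬(x = g ∧ y = h) := by
    rintro ⟨rfl, rfl⟩
    rw [hxpos, hypos] at H5
    exact lt_asymm hlr H5
  have hne : ∀ w : Fin n, w ≠ x → w ≠ y →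
      (pos p w < leftPos i ↔ pos p w < rightPos i) ∧ (leftPos i < pos p w ↔ rightPos i < pos p w) := by
    intro w h1 h2
    rw [hx, ne_eq, ← pos_eq_iff] at h1
    rw [hy, ne_eq, ← pos_eq_iff] at h2
    simp only [Fin.lt_def, leftPos, rightPos, Fin.ext_iff] at *
    omega
  -- The threshold set is updated by "or" on the left and "and" on the right; elsewhere only the
  -- names of g and h matter.
  have hz : ∀ g' h' : Fin n,
      ((((k ≤ x.val ∧ x ≠ h) ∨ x = g) ∨ ((k ≤ y.val ∧ y ≠ h) ∨ y = g)) ↔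
        ((k ≤ y.val ∧ y ≠ h') ∨ y = g')) →
      ((((k ≤ x.val ∧ x ≠ h) ∨ x = g) ∧ ((k ≤ y.val ∧ y ≠ h) ∨ y = g)) ↔
        ((k ≤ x.val ∧ x ≠ h') ∨ x = g')) →
      (∀ w, w ≠ x → w ≠ y → (w = h ↔ w = h') ∧ (w = g ↔ w = g')) →
      ∀ j, k ≤ (demMul z i j).val ↔
        (k ≤ ((p * simpleRefl i) j).val ∧ (p * simpleRefl i) j ≠ h') ∨
          (p * simpleRefl i) j = g' := by
    intro g' h' hl hr hw j
    rw [Equiv.Perm.mul_apply]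
    have hHl := H6 (leftPos i)
    have hHr := H6 (rightPos i)
    rw [← hx] at hHl
    rw [← hy] at hHr
    by_cases h1 : j = leftPos i
    · subst h1
      rw [demMul_leftPos, simpleRefl_leftPos, Fin.coe_max, le_max_iff, hHl, hHr, ← hy, hl]
    · by_cases h2 : j = rightPos i
      · subst h2
        rw [demMul_rightPos, simpleRefl_rightPos, Fin.coe_min, le_min_iff, hHl, hHr, ← hx, hr]
      · rw [demMul_of_ne z h1 h2, simpleRefl_of_ne h1 h2, H6 j]
        obtain ⟨e1, e2⟩ := hw (p j) (by rw [hx]; exact p.injective.ne h1)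
          (by rw [hy]; exact p.injective.ne h2)
        rw [ne_eq, e1, e2]
  -- The extra position of z stays on the left, where p now has y.
  by_cases hA : x = g ∧ y.val < k
  · obtain ⟨rfl, hyk⟩ := hA
    refine ⟨y, h, ⟨hyk, H2, H3.trans hxy.le, H4, ?_, ?_, ?_, H8, ?_, ?_⟩⟩
    · rw [hord h y (by omega) (by omega), hypos]
      rw [hxpos] at H5
      exact H5.trans hlr
    · apply hz
      · omega
      · omega
      · intro w h1 h2
        simp [h1, h2]
    · right
      rw [H9 y hxy hyk, hxpos, hypos]
      exact hlr
    · intro w hw hwk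
      rw [H9 w (hxy.trans hw) hwk, hord y w (by omega) (by omega), hxpos, hypos]
      exact (hne w (by omega) (by omega)).2
    · intro w hw hwk
      rw [H10 w hw hwk, hord h w (by omega) (by omega)]
  -- The missing position of z stays on the right, where p now has x.
  · by_cases hB : y = h ∧ k ≤ x.val
    · obtain ⟨rfl, hxk⟩ := hB
      refine ⟨g, x, ⟨H1, hxk, H3, hxy.le.trans H4, ?_, ?_, H7, ?_, ?_, ?_⟩⟩
      · rw [hord x g (by omega) (by omega), hxpos]
        rw [hypos] at H5
        exact hlr.trans H5
      · apply hz
        · omega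
        · omega
        · intro w h1 h2
          simp [h1, h2]
      · right
        rw [H10 x hxy hxk, hxpos, hypos]
        exact hlr.asymm
      · intro w hw hwk
        rw [H9 w hw hwk, hord g w (by omega) (by omega)]
      · intro w hw hwk
        rw [H10 w (hw.trans hxy) hwk, hord x w (by omega) (by omega), hxpos, hypos]
        exact (hne w (by omega) (by omega)).2.symm
    · refine ⟨g, h, ⟨H1, H2, H3, H4, ?_, ?_, H7, H8, ?_, ?_⟩⟩
      · rw [hord h g (by omega) (by omega)]
        exact H5
      · apply hz
        · omega
        · omega
        · simp
      · intro w hw hwk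
        rw [H9 w hw hwk, hord g w (by omega) (by omega)]
      · intro w hw hwk
        rw [H10 w hw hwk, hord h w (by omega) (by omega)]

/-- The 0-Hecke action of a word whose letters are all ascents transports a defect. -/
theorem Defect.foldl {n : ℕ} {r : Fin n → Prop} {a c : Fin n} {k : ℕ} {V : Word n} :
    ∀ {U : Word n} {z : Equiv.Perm (Fin n)} {g h : Fin n},
      U ++ V ∈ reducedWords (longest n) → Defect r a c k (wordProd U) z g h →
      ∃ g' h', Defect r a c k (longest n) (V.foldl demMul z) g' h' := by
  induction V with
  | nil =>
    intro U z g h hR H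
    rw [List.append_nil] at hR
    rw [← hR.1]
    exact ⟨g, h, H⟩
  | cons i V ih =>
    intro U z g h hR H
    obtain ⟨g', h', H'⟩ := H.step (ascent_of_reduced_append hR)
    exact ih (U := U ++ [i]) (by simpa using hR) (by simpa using H')

theorem AgreesAt.foldl {n : ℕ} {k : ℕ} {V : Word n} :
    ∀ {U : Word n} {z : Equiv.Perm (Fin n)},
      U ++ V ∈ reducedWords (longest n) → AgreesAt k (wordProd U) z →
      AgreesAt k (longest n) (V.foldl demMul z) := by
  induction V with
  | nil =>
    intro U z hR H
    rw [List.append_nil] at hR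
    rwa [← hR.1]
  | cons i V ih =>
    intro U z hR H
    exact ih (U := U ++ [i]) (by simpa using hR)
      (by simpa using H.step (ascent_of_reduced_append hR))

/-- Birth of the defect, with g = a and h = c: p has performed the exchange and z has not. -/
theorem Defect.of_swap {n : ℕ} {u : Equiv.Perm (Fin n)} {i : Fin (n - 1)} {k : ℕ}
    (h1 : (u (leftPos i)).val < k) (h2 : k ≤ (u (rightPos i)).val) :
    Defect (fun y => pos u (u (rightPos i)) < pos u y) (u (leftPos i)) (u (rightPos i)) k
      (u * simpleRefl i) u (u (leftPos i)) (u (rightPos i)) := by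
  refine ⟨h1, h2, le_rfl, le_rfl, ?_, ?_, Or.inl rfl, Or.inl rfl, ?_, ?_⟩
  · simp [pos_mul_simpleRefl, leftPos_lt_rightPos]
  · intro j
    rw [Equiv.Perm.mul_apply]
    by_cases hl : j = leftPos i
    · subst hl
      simp [(apply_leftPos_ne u i).symm]
      omega
    · by_cases hr : j = rightPos i
      · subst hr
        simp [h2]
      · rw [simpleRefl_of_ne hl hr]
        simp [u.injective.eq_iff, hl, hr]
  · intro y hy hyk
    have hyr : y ≠ u (rightPos i) := by omega
    have hyl : y ≠ u (leftPos i) := hy.ne'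
    rw [ne_eq, ← pos_eq_iff] at hyl hyr
    rw [pos_mul_simpleRefl, pos_mul_simpleRefl, pos_apply, pos_apply, simpleRefl_leftPos,
      simpleRefl_of_ne hyl hyr]
  · intro y hy hyk
    have hyr : y ≠ u (rightPos i) := hy.ne
    have hyl : y ≠ u (leftPos i) := by omega
    rw [ne_eq, ← pos_eq_iff] at hyl hyr
    rw [pos_mul_simpleRefl, pos_mul_simpleRefl, pos_apply, simpleRefl_rightPos,
      simpleRefl_of_ne hyl hyr]
    simp only [Fin.lt_def, leftPos, rightPos, Fin.ext_iff] at *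
    omega

theorem AgreesAt.of_swap {n : ℕ} {u : Equiv.Perm (Fin n)} {i : Fin (n - 1)} {k : ℕ}
    (h : k ≤ (u (leftPos i)).val ↔ k ≤ (u (rightPos i)).val) :
    AgreesAt k (u * simpleRefl i) u := by
  intro j
  rw [Equiv.Perm.mul_apply]
  by_cases hl : j = leftPos i
  · subst hl
    simpa using h
  · by_cases hr : j = rightPos i
    · subst hr
      simpa using h.symm
    · rw [simpleRefl_of_ne hl hr]

/-! ### Displacement in the shortened Demazure product -/

/-- The displacement caused by omitting the letter that exchanges the values `a` and `c`: the
support is the interval `[a, c]`, and a value strictly between moves right if it satisfies `r`,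
and left otherwise. -/
theorem displacement_of_defect {n : ℕ} {r : Fin n → Prop} {a c : Fin n} (hac : a < c)
    {x : Equiv.Perm (Fin n)}
    (hin : ∀ k : ℕ, a.val < k → k ≤ c.val → ∃ g h, Defect r a c k (longest n) x g h)
    (hout : ∀ k : ℕ, (k ≤ a.val ∨ c.val < k) → AgreesAt k (longest n) x) :
    supp x = Finset.Icc a c ∧
      ∀ b, a < b → b < c → (r b → sigma b x = 1) ∧ (¬r b → sigma b x = -1) := by
  have hmid : ∀ b, a < b → b < c → (r b → longest n (pos x b) < b) ∧
      (¬r b → b < longest n (pos x b)) := by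
    intro b hab hbc
    obtain ⟨g, h, H⟩ := hin b hab hbc.le
    obtain ⟨g', h', H'⟩ := hin (b + 1) (by omega) hbc
    -- The value b passes the threshold b but not b + 1. These two facts pin down the value w of the
    -- longest element at the position of b in x.
    have e1 := (H.iff_of (pos x b)).1 (by simp)
    have e2 := mt (H'.iff_of (pos x b)).2 (by simp)
    rw [not_or, not_and, not_not] at e2
    obtain ⟨e2, e3⟩ := e2
    have P : ∀ u v : Fin n, pos (longest n) u < pos (longest n) v ↔ v < u := by
      intro u v
      rw [pos_longest, pos_longest, Fin.rev_lt_rev]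
    have F1 := H.g_lt
    have F2 := H.le_h
    have F3 := H'.g_lt
    have F4 := H'.le_h
    -- In the longest element larger values stand further left, so `g_above` and `h_below` make g
    -- and h extremal.
    have G1 : ∀ y, g < y → y.val < b.val → ¬r y := fun y h1 h2 => by
      rw [H.g_above y h1 h2, P]
      exact h1.asymm
    have G2 : ∀ y, y < h → b.val ≤ y.val → r y := fun y h1 h2 => by
      rwa [H.h_below y h1 h2, P]
    have G3 : ∀ y, g' < y → y.val < b.val + 1 → ¬r y := fun y h1 h2 => by
      rw [H'.g_above y h1 h2, P]
      exact h1.asymm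
    have G4 : ∀ y, y < h' → b.val + 1 ≤ y.val → r y := fun y h1 h2 => by
      rwa [H'.h_below y h1 h2, P]
    generalize longest n (pos x b) = w at *
    constructor
    -- Here g' = b and h' = h, which leaves only w = g < b.
    · intro hrb
      have hg' : g' = b := by
        by_contra hne
        exact G3 b (by omega) (by omega) hrb
      have hhb : h ≠ b := by
        rintro rfl
        rcases H.h_mem with h1 | h1
        · exact hbc.ne h1
        · exact h1 hrb
      have hhh : h' = h := by
        rcases lt_trichotomy h' h with h1 | h1 | h1
        · exfalso
          have := G2 h' h1 (by omega)
          rcases H'.h_mem with h2 | h2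
          · exact absurd H.h_le (by rw [← h2]; exact not_le.2 h1)
          · exact h2 this
        · exact h1
        · exfalso
          have := G4 h h1 (by omega)
          rcases H.h_mem with h2 | h2
          · exact absurd H'.h_le (by rw [← h2]; exact not_le.2 h1)
          · exact h2 this
      omega
    -- Here h = b and g' = g, which leaves only w = h' > b.
    · intro hrb
      have hh : h = b := by
        by_contra hne
        exact hrb (G2 b (by omega) le_rfl)
      have hgb : g' ≠ b := by
        rintro rfl
        rcases H'.g_mem with h1 | h1
        · exact hab.ne' h1
        · exact hrb h1
      have hgg : g' = g := by
        rcases lt_trichotomy g' g with h1 | h1 | h1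
        · exfalso
          have := G3 g h1 (by omega)
          rcases H.g_mem with h2 | h2
          · exact absurd H'.le_g (by rw [← h2]; exact not_le.2 h1)
          · exact this h2
        · exact h1
        · exfalso
          have := G1 g' h1 (by omega)
          rcases H'.g_mem with h2 | h2
          · exact absurd H.le_g (by rw [← h2]; exact not_le.2 h1)
          · exact this h2
      omega
  have hsupp : ∀ t, t ∈ supp x ↔ longest n (pos x t) ≠ t := by
    intro t
    rw [supp, Finset.mem_filter, and_iff_right (Finset.mem_univ _), ne_eq, ne_eq,
      eq_comm (a := longest n (pos x t)), ← pos_eq_iff, eq_comm]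
  constructor
  · ext t
    rw [hsupp, Finset.mem_Icc]
    rcases lt_trichotomy t a with h | rfl | h
    · have e1 := hout t (by omega) (pos x t)
      have e2 := hout (t + 1) (by omega) (pos x t)
      rw [apply_pos] at e1 e2
      omega
    -- At the threshold a + 1 the bounds force g = a, so a has left its position.
    · obtain ⟨g, h, H⟩ := hin (t + 1) (by omega) (by omega)
      have e1 := hout t (by omega) (pos x t)
      have e2 := H.iff_of (pos x t)
      rw [apply_pos] at e1 e2
      have := H.le_h
      have := H.le_g
      have := H.g_lt
      omega
    · rcases lt_trichotomy t c with h' | rfl | h'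
      · have := hmid t h h'
        have h3 : longest n (pos x t) ≠ t := by
          by_cases hr : r t
          · exact (this.1 hr).ne
          · exact (this.2 hr).ne'
        simp [h3, h.le, h'.le]
      · obtain ⟨g, h, H⟩ := hin t (by omega) (by omega)
        have e1 := hout (t + 1) (by omega) (pos x t)
        have e2 := H.iff_of (pos x t)
        rw [apply_pos] at e1 e2
        have := H.le_h
        have := H.h_le
        have := H.g_lt
        omega
      · have e1 := hout t (by omega) (pos x t)
        have e2 := hout (t + 1) (by omega) (pos x t)
        rw [apply_pos] at e1 e2
        omega
  · intro b hab hbc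
    have := hmid b hab hbc
    simp only [longest_apply, Fin.lt_def, Fin.val_rev] at this
    rw [sigma, pos_longest, Fin.val_rev]
    constructor
    · intro hr
      have := this.1 hr
      exact Int.sign_eq_one_of_pos (by omega)
    · intro hr
      have := this.2 hr
      exact Int.sign_eq_neg_one_of_neg (by omega)

theorem dem_eraseIdx {n : ℕ} {R : Word n} (hR : R ∈ reducedWords (longest n)) {j : ℕ}
    (hj : j ≤ R.length) :
    dem (R.eraseIdx j) = (R.drop (j + 1)).foldl demMul (wordProd (R.take j)) := by
  rw [List.eraseIdx_eq_take_drop_succ, dem, List.foldl_append]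
  congr 1
  exact dem_take_of_reduced hR hj

/-- The displacement of the Demazure product of a reduced word with one letter omitted. -/
theorem displacement_dem_eraseIdx {n : ℕ} {R : Word n} (hR : R ∈ reducedWords (longest n))
    {j : ℕ} (hj : j < R.length) {a c : Fin n} (ha : a = wordProd (R.take j) (leftPos R[j]))
    (hc : c = wordProd (R.take j) (rightPos R[j])) :
    supp (dem (R.eraseIdx j)) = Finset.Icc a c ∧ ∀ b, a < b → b < c →
      (pos (wordProd (R.take j)) c < pos (wordProd (R.take j)) b →
        sigma b (dem (R.eraseIdx j)) = 1) ∧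
      (¬pos (wordProd (R.take j)) c < pos (wordProd (R.take j)) b →
        sigma b (dem (R.eraseIdx j)) = -1) := by
  have hac : a < c := by
    rw [ha, hc]
    exact ascent_of_reduced hR hj
  have hR' : R.take (j + 1) ++ R.drop (j + 1) ∈ reducedWords (longest n) := by
    rwa [List.take_append_drop]
  rw [dem_eraseIdx hR hj.le]
  refine displacement_of_defect
    (r := fun y => pos (wordProd (R.take j)) c < pos (wordProd (R.take j)) y) hac ?_ ?_
  · intro k h1 h2
    refine Defect.foldl hR' ?_ (g := a) (h := c)
    rw [wordProd_take_succ hj, ha, hc]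
    exact Defect.of_swap (ha ▸ h1) (hc ▸ h2)
  · intro k hk
    refine AgreesAt.foldl hR' ?_
    rw [wordProd_take_succ hj]
    apply AgreesAt.of_swap
    rw [← ha, ← hc]
    omega

/-! ### The triple invariant, exchanges and the value of Θ -/

/-- At some time, the value `b` stands to the left of both `a` and `c`. -/
def LeadsAt {n : ℕ} (R : Word n) (a b c : Fin n) : Prop :=
  ∃ t, pos (wordProd (R.take t)) b < pos (wordProd (R.take t)) a ∧
    pos (wordProd (R.take t)) b < pos (wordProd (R.take t)) c

theorem pos_lt_mono {n : ℕ} {R : Word n} (hR : R ∈ reducedWords (longest n)) {a b : Fin n}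
    (hab : a < b) {s t : ℕ} (hst : s ≤ t)
    (h : pos (wordProd (R.take s)) b < pos (wordProd (R.take s)) a) :
    pos (wordProd (R.take t)) b < pos (wordProd (R.take t)) a :=
  (mem_invs.1 (invs_take_mono hR hst (mem_invs.2 ⟨hab, h⟩))).2

theorem pos_lt_length {n : ℕ} {R : Word n} (hR : R ∈ reducedWords (longest n)) {a b : Fin n}
    (hab : a < b) :
    pos (wordProd (R.take R.length)) b < pos (wordProd (R.take R.length)) a := by
  rw [List.take_length, hR.1, pos_longest, pos_longest, Fin.rev_lt_rev]
  exact hab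

/-- Inversions persist along a reduced word, so b leads at some time exactly when it passes a before
c passes it. -/
theorem tau_lt_tau_iff {n : ℕ} {R : Word n} (hR : R ∈ reducedWords (longest n)) {a b c : Fin n}
    (hab : a < b) (hbc : b < c) : tau R a b < tau R b c ↔ LeadsAt R a b c := by
  constructor
  · intro h
    have h1 : pos (wordProd (R.take (tau R a b))) b < pos (wordProd (R.take (tau R a b))) a :=
      Nat.sInf_mem (s := {t : ℕ | pos (wordProd (R.take t)) b < pos (wordProd (R.take t)) a})
        ⟨_, pos_lt_length hR hab⟩
    have h2 : ¬pos (wordProd (R.take (tau R a b))) c < pos (wordProd (R.take (tau R a b))) b :=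
      Nat.notMem_of_lt_sInf
        (s := {t : ℕ | pos (wordProd (R.take t)) c < pos (wordProd (R.take t)) b}) h
    exact ⟨_, h1, lt_of_le_of_ne (not_lt.1 h2) ((pos_injective _).ne hbc.ne)⟩
  · rintro ⟨t, h1, h2⟩
    have h3 : tau R a b ≤ t := Nat.sInf_le h1
    refine h3.trans_lt ?_
    by_contra hcon
    have h4 : pos (wordProd (R.take (tau R b c))) c < pos (wordProd (R.take (tau R b c))) b :=
      Nat.sInf_mem (s := {t : ℕ | pos (wordProd (R.take t)) c < pos (wordProd (R.take t)) b})
        ⟨_, pos_lt_length hR hbc⟩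
    exact lt_asymm h2 (pos_lt_mono hR hbc (not_lt.1 hcon) h4)

open Classical in
theorem tripleInv_eq {n : ℕ} {R : Word n} (hR : R ∈ reducedWords (longest n)) {a b c : Fin n}
    (hab : a < b) (hbc : b < c) : tripleInv R a b c = if LeadsAt R a b c then 1 else -1 := by
  simp only [tripleInv, tau_lt_tau_iff hR hab hbc]

theorem tripleInv_eq_iff {n : ℕ} {R₁ R₂ : Word n} (h₁ : R₁ ∈ reducedWords (longest n))
    (h₂ : R₂ ∈ reducedWords (longest n)) {a b c : Fin n} (hab : a < b) (hbc : b < c) :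
    tripleInv R₁ a b c = tripleInv R₂ a b c ↔ (LeadsAt R₁ a b c ↔ LeadsAt R₂ a b c) := by
  rw [tripleInv_eq h₁ hab hbc, tripleInv_eq h₂ hab hbc]
  by_cases p : LeadsAt R₁ a b c <;> by_cases q : LeadsAt R₂ a b c <;> simp [p, q]

/-- Every pair of values is exchanged at some time. -/
theorem exists_exchange {n : ℕ} {R : Word n} (hR : R ∈ reducedWords (longest n)) {a c : Fin n}
    {t : ℕ} (ht : pos (wordProd (R.take t)) a < pos (wordProd (R.take t)) c) (hac : a < c) :
    ∃ j, ∃ hj : j < R.length, t ≤ j ∧ a = wordProd (R.take j) (leftPos R[j]) ∧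
      c = wordProd (R.take j) (rightPos R[j]) := by
  have hex : ∃ m, pos (wordProd (R.take m)) c < pos (wordProd (R.take m)) a :=
    ⟨_, pos_lt_length hR hac⟩
  classical
  have h1 := Nat.find_spec hex
  have h2 : t < Nat.find hex := by
    by_contra hcon
    exact lt_asymm ht (pos_lt_mono hR hac (not_lt.1 hcon) h1)
  -- The letter at index j produces the prefix of length j + 1, the first in which the pair is
  -- inverted.
  obtain ⟨j, hj⟩ : ∃ j, Nat.find hex = j + 1 := ⟨Nat.find hex - 1, by omega⟩
  have h3 : ¬pos (wordProd (R.take j)) c < pos (wordProd (R.take j)) a :=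
    Nat.find_min hex (by omega)
  rw [hj] at h1
  have hjl : j < R.length := by
    by_contra hcon
    rw [List.take_of_length_le (by omega)] at h1 h3
    exact h3 h1
  refine ⟨j, hjl, by omega, ?_⟩
  have h4 := mem_invs.2 ⟨hac, h1⟩
  rw [invs_take_succ hR hjl, Finset.mem_insert] at h4
  rcases h4 with h4 | h4
  · exact Prod.mk.inj h4
  · exact absurd (mem_invs.1 h4).2 h3

/-- Every pair of values is exchanged at most once. -/
theorem exchange_unique {n : ℕ} {R : Word n} (hR : R ∈ reducedWords (longest n)) {j k : ℕ}
    (hj : j < R.length) (hk : k < R.length)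
    (hl : wordProd (R.take j) (leftPos R[j]) = wordProd (R.take k) (leftPos R[k]))
    (hr : wordProd (R.take j) (rightPos R[j]) = wordProd (R.take k) (rightPos R[k])) :
    j = k := by
  have key : ∀ {j k : ℕ} (hj : j < R.length) (hk : k < R.length),
      wordProd (R.take j) (leftPos R[j]) = wordProd (R.take k) (leftPos R[k]) →
      wordProd (R.take j) (rightPos R[j]) = wordProd (R.take k) (rightPos R[k]) → ¬j < k := by
    intro j k hj hk hl hr hjk
    have h1 := invs_take_succ hR hj
    have h2 := invs_take_mono hR (show j + 1 ≤ k from hjk)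
    simp only [h1, hl, hr] at h2
    exact notMem_invs_of_ascent (h2 (Finset.mem_insert_self _ _))
  have h1 := key hj hk hl hr
  have h2 := key hk hj hl.symm hr.symm
  omega

/-- When a and c are adjacent, b is left of both or right of both. In the latter case, b has not
passed a before, and c stays ahead of b afterwards. -/
theorem leadsAt_iff_of_exchange {n : ℕ} {R : Word n} (hR : R ∈ reducedWords (longest n))
    {a b c : Fin n} (hab : a < b) (hbc : b < c) {j : ℕ} (hj : j < R.length)
    (ha : a = wordProd (R.take j) (leftPos R[j]))
    (hc : c = wordProd (R.take j) (rightPos R[j])) :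
    LeadsAt R a b c ↔ pos (wordProd (R.take j)) b < pos (wordProd (R.take j)) c := by
  have hpa := pos_eq_iff.2 ha
  have hpc := pos_eq_iff.2 hc
  have hba : pos (wordProd (R.take j)) b ≠ pos (wordProd (R.take j)) a :=
    (pos_injective _).ne hab.ne'
  have hcb : pos (wordProd (R.take j)) b ≠ pos (wordProd (R.take j)) c :=
    (pos_injective _).ne hbc.ne
  have hadj : pos (wordProd (R.take j)) b < pos (wordProd (R.take j)) c →
      pos (wordProd (R.take j)) b < pos (wordProd (R.take j)) a := by
    rw [hpa, hpc] at *
    simp only [Fin.lt_def, leftPos, rightPos, Fin.ext_iff, ne_eq] at *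
    omega
  constructor
  · rintro ⟨t, h1, h2⟩
    by_contra hcon
    have hcb' := lt_of_le_of_ne (not_lt.1 hcon) hcb.symm
    rcases le_or_gt t j with h | h
    · have h3 := pos_lt_mono hR hab h h1
      refine hcon (h3.trans ?_)
      rw [hpa, hpc]
      exact leftPos_lt_rightPos _
    · exact lt_asymm h2 (pos_lt_mono hR hbc h.le hcb')
  · intro h
    exact ⟨j, hadj h, h⟩

theorem Theta_eq_neg_tripleInv {n : ℕ} {R : Word n} (hR : R ∈ reducedWords (longest n))
    {a b c : Fin n} (hab : a < b) (hbc : b < c) : Theta R a b c = -tripleInv R a b c := by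
  have hac := hab.trans hbc
  obtain ⟨j, hj, -, ha, hc⟩ := exists_exchange hR (t := 0) (by simpa [pos] using hac) hac
  have hD := displacement_dem_eraseIdx hR hj ha hc
  -- The sum over x, weighted by counts of omissions, becomes a sum over omitted letters.
  have h1 : Theta R a b c = ∑ k : Fin R.length,
      if supp (dem (R.eraseIdx k)) = Finset.Icc a c then sigma b (dem (R.eraseIdx k)) else 0 := by
    unfold Theta
    simp only [secondCoeff_eq_card (show 2 ≤ n by omega) hR]
    rw [← Finset.sum_filter]
    rw [← Finset.sum_fiberwise_of_maps_to
      (s := Finset.univ.filter fun k : Fin R.length =>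
        supp (dem (R.eraseIdx k)) = Finset.Icc a c)
      (t := Finset.univ.filter fun x => supp x = Finset.Icc a c)
      (g := fun k => dem (R.eraseIdx k)) (by simp)]
    refine Finset.sum_congr rfl fun x hx => ?_
    rw [Finset.mem_filter] at hx
    rw [Finset.filter_filter, Finset.sum_congr rfl (g := fun _ => sigma b x)
      (fun k hk => by rw [(Finset.mem_filter.1 hk).2.2]), Finset.sum_const, nsmul_eq_mul]
    congr 3
    ext k
    simp only [Finset.mem_filter, Finset.mem_univ, true_and]
    exact ⟨fun h => ⟨h ▸ hx.2, h⟩, fun h => h.2⟩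
  rw [h1, Finset.sum_eq_single (⟨j, hj⟩ : Fin R.length)]
  · rw [if_pos hD.1, tripleInv_eq hR hab hbc, leadsAt_iff_of_exchange hR hab hbc hj ha hc]
    have hne : pos (wordProd (R.take j)) b ≠ pos (wordProd (R.take j)) c :=
      (pos_injective _).ne hbc.ne
    obtain ⟨e1, e2⟩ := hD.2 b hab hbc
    split_ifs with h
    · exact e2 h.asymm
    · rw [e1 (lt_of_le_of_ne (not_lt.1 h) hne.symm)]
      norm_num
  -- Any other letter exchanges another pair, hence has another interval as support.
  · intro k _ hk
    have hDk := displacement_dem_eraseIdx hR k.isLt rfl rfl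
    refine if_neg fun h => hk ?_
    rw [hDk.1] at h
    obtain ⟨e1, e2⟩ := (Set.Icc_eq_Icc_iff (ascent_of_reduced hR k.isLt).le).1
      (by simpa using congrArg (fun s : Finset (Fin n) => (s : Set (Fin n))) h)
    exact Fin.ext (exchange_unique hR k.isLt hj (e1.trans ha) (e2.trans hc))
  · simp

/-! ### Commutation classes -/

theorem simpleRefl_comm {n : ℕ} {i j : Fin (n - 1)}
    (h : i.val + 1 < j.val ∨ j.val + 1 < i.val) :
    simpleRefl i * simpleRefl j = simpleRefl j * simpleRefl i := by
  ext t
  simp only [Equiv.Perm.mul_apply, simpleRefl_val]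
  split_ifs <;> omega

theorem lt_simpleRefl_iff {n : ℕ} {i : Fin (n - 1)} {t u : Fin n} (h₁ : t ≠ leftPos i)
    (h₂ : t ≠ rightPos i) : t < simpleRefl i u ↔ t < u := by
  simp only [Fin.lt_def, simpleRefl_val, leftPos, rightPos, Fin.ext_iff, ne_eq] at *
  split_ifs <;> omega

theorem CommMove.symm {n : ℕ} {R R' : Word n} (h : CommMove R R') : CommMove R' R := by
  obtain ⟨T₁, T₂, i, j, hij, rfl, rfl⟩ := h
  exact ⟨T₁, T₂, j, i, hij.symm, rfl, rfl⟩

theorem SameCommClass.symm {n : ℕ} {R R' : Word n} (h : SameCommClass R R') :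
    SameCommClass R' R := by
  induction h with
  | refl => exact Relation.ReflTransGen.refl
  | tail _ h ih => exact Relation.ReflTransGen.head h.symm ih

theorem CommMove.reduced {n : ℕ} {R R' : Word n} (h : CommMove R R')
    {w : Equiv.Perm (Fin n)} (hR : R ∈ reducedWords w) : R' ∈ reducedWords w := by
  obtain ⟨T₁, T₂, i, j, hij, rfl, rfl⟩ := h
  refine ⟨?_, ?_⟩
  · rw [← hR.1]
    simp only [wordProd_append, wordProd_cons]
    rw [← mul_assoc (simpleRefl j), ← simpleRefl_comm hij, mul_assoc]
  · rw [← hR.2]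
    simp

/-- Only the prefix ending between the two letters changes. If i moves b, then j does not, and b
still leads after both letters; otherwise b already led before i. -/
theorem CommMove.leadsAt {n : ℕ} {R R' : Word n} (h : CommMove R R') {a b c : Fin n}
    (H : LeadsAt R a b c) : LeadsAt R' a b c := by
  obtain ⟨T₁, T₂, i, j, hij, rfl, rfl⟩ := h
  obtain ⟨t, h1, h2⟩ := H
  have hcomm : wordProd (T₁ ++ j :: [i]) = wordProd (T₁ ++ i :: [j]) := by
    simp [simpleRefl_comm hij]
  rcases lt_trichotomy t (T₁.length + 1) with ht | rfl | ht
  · refine ⟨t, ?_⟩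
    rw [List.take_append_of_le_length (by omega)] at h1 h2 ⊢
    exact ⟨h1, h2⟩
  · have e : (T₁ ++ i :: j :: T₂).take (T₁.length + 1) = T₁ ++ [i] := by
      simp [List.take_append]
    rw [e, wordProd_append, wordProd_cons, wordProd_nil, mul_one, pos_mul_simpleRefl,
      pos_mul_simpleRefl] at h1 h2
    have key : (pos (wordProd T₁) b < pos (wordProd T₁) a ∧
          pos (wordProd T₁) b < pos (wordProd T₁) c) ∨
        (simpleRefl j (simpleRefl i (pos (wordProd T₁) b)) <
            simpleRefl j (simpleRefl i (pos (wordProd T₁) a)) ∧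
          simpleRefl j (simpleRefl i (pos (wordProd T₁) b)) <
            simpleRefl j (simpleRefl i (pos (wordProd T₁) c))) := by
      generalize pos (wordProd T₁) a = α at *
      generalize pos (wordProd T₁) b = β at *
      generalize pos (wordProd T₁) c = γ at *
      by_cases hβ : β = leftPos i ∨ β = rightPos i
      · right
        have hβ' : simpleRefl i β ≠ leftPos j ∧ simpleRefl i β ≠ rightPos j := by
          rcases hβ with rfl | rfl
          · rw [simpleRefl_leftPos]
            simp only [leftPos, rightPos, Fin.ext_iff, ne_eq]
            omega
          · rw [simpleRefl_rightPos]
            simp only [leftPos, rightPos, Fin.ext_iff, ne_eq]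
            omega
        rw [simpleRefl_of_ne hβ'.1 hβ'.2, lt_simpleRefl_iff hβ'.1 hβ'.2,
          lt_simpleRefl_iff hβ'.1 hβ'.2]
        exact ⟨h1, h2⟩
      · left
        rw [not_or] at hβ
        rw [simpleRefl_of_ne hβ.1 hβ.2, lt_simpleRefl_iff hβ.1 hβ.2] at h1 h2
        exact ⟨h1, h2⟩
    rcases key with h | h
    · refine ⟨T₁.length, ?_⟩
      simpa using h
    · refine ⟨T₁.length + 2, ?_⟩
      have e : (T₁ ++ j :: i :: T₂).take (T₁.length + 2) = T₁ ++ [j, i] := by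
        simp [List.take_append]
      rw [e, hcomm]
      simpa [← mul_assoc, pos_mul_simpleRefl] using h
  · refine ⟨t, ?_⟩
    obtain ⟨m, rfl⟩ : ∃ m, t = T₁.length + (m + 2) := ⟨t - T₁.length - 2, by omega⟩
    have e : ∀ u v : Fin (n - 1), (T₁ ++ u :: v :: T₂).take (T₁.length + (m + 2)) =
        (T₁ ++ u :: [v]) ++ T₂.take m := by
      intro u v
      simp [List.take_append]
    rw [e, wordProd_append] at h1 h2 ⊢
    rw [hcomm]
    exact ⟨h1, h2⟩

theorem SameCommClass.reduced {n : ℕ} {R R' : Word n} (h : SameCommClass R R')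
    {w : Equiv.Perm (Fin n)} (hR : R ∈ reducedWords w) : R' ∈ reducedWords w := by
  induction h with
  | refl => exact hR
  | tail _ h ih => exact h.reduced ih

theorem SameCommClass.leadsAt_iff {n : ℕ} {R R' : Word n} (h : SameCommClass R R')
    {a b c : Fin n} : LeadsAt R a b c ↔ LeadsAt R' a b c := by
  have : ∀ {R R' : Word n}, SameCommClass R R' → LeadsAt R a b c → LeadsAt R' a b c := by
    intro R R' h H
    induction h with
    | refl => exact H
    | tail _ h ih => exact h.leadsAt ih
  exact ⟨this h, this h.symm⟩

theorem sameCommClass_move_front {n : ℕ} (U Q : Word n) (i : Fin (n - 1)) (P : Word n)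
    (hP : ∀ k ∈ P, k.val + 1 < i.val ∨ i.val + 1 < k.val) :
    SameCommClass (U ++ (P ++ i :: Q)) (U ++ i :: (P ++ Q)) := by
  induction P generalizing U with
  | nil => exact Relation.ReflTransGen.refl
  | cons k P ih =>
    have h1 := ih (U ++ [k]) fun l hl => hP l (List.mem_cons_of_mem _ hl)
    refine Relation.ReflTransGen.tail (b := U ++ k :: i :: (P ++ Q)) ?_ ?_
    · rw [List.append_assoc, List.append_assoc] at h1
      exact h1
    · exact ⟨U, P ++ Q, k, i, hP k List.mem_cons_self, rfl, by simp⟩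

/-- If the letter following the prefix `U` in one reduced word exchanges `a` and `c`, then in
another reduced word with the same triple invariants the letters between `U` and the exchange of
`a` and `c` do not move `a` or `c`. -/
theorem far_of_leadsAt_iff {n : ℕ} {U V₁ V₂ : Word n} {i : Fin (n - 1)}
    (h₁ : U ++ i :: V₁ ∈ reducedWords (longest n)) (h₂ : U ++ V₂ ∈ reducedWords (longest n))
    (hT : ∀ a b c : Fin n, a < b → b < c →
      (LeadsAt (U ++ i :: V₁) a b c ↔ LeadsAt (U ++ V₂) a b c)) :
    ∃ P Q : Word n, V₂ = P ++ i :: Q ∧ ∀ k ∈ P, k.val + 1 < i.val ∨ i.val + 1 < k.val := by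
  have hac : wordProd U (leftPos i) < wordProd U (rightPos i) := ascent_of_reduced_append h₁
  obtain ⟨a, ha⟩ : ∃ a, a = wordProd U (leftPos i) := ⟨_, rfl⟩
  obtain ⟨c, hc⟩ : ∃ c, c = wordProd U (rightPos i) := ⟨_, rfl⟩
  rw [← ha, ← hc] at hac
  have hUa : pos (wordProd U) a = leftPos i := pos_eq_iff.2 ha
  have hUc : pos (wordProd U) c = rightPos i := pos_eq_iff.2 hc
  have hU₁ : (U ++ i :: V₁).take U.length = U := List.take_left' rfl
  have hU₂ : (U ++ V₂).take U.length = U := List.take_left' rfl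
  have hU₁' : wordProd ((U ++ i :: V₁).take (U.length + 1)) = wordProd U * simpleRefl i := by
    rw [wordProd_take_succ (by simp), hU₁]
    simp
  obtain ⟨R₁, hR₁⟩ : ∃ R₁, R₁ = U ++ i :: V₁ := ⟨_, rfl⟩
  obtain ⟨R₂, hR₂⟩ : ∃ R₂, R₂ = U ++ V₂ := ⟨_, rfl⟩
  rw [← hR₁] at h₁ hT hU₁ hU₁'
  rw [← hR₂] at h₂ hT hU₂
  obtain ⟨j, hj, hUj, hja, hjc⟩ := exists_exchange h₂ (t := U.length) (a := a) (c := c)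
    (by rw [hU₂, hUa, hUc]; exact leftPos_lt_rightPos i) hac
  have key : ∀ t, t ≤ j → U.length ≤ t →
      pos (wordProd (R₂.take t)) a = leftPos i ∧ pos (wordProd (R₂.take t)) c = rightPos i ∧
      ∀ m (hm : m < R₂.length), U.length ≤ m → m < t →
        R₂[m].val + 1 < i.val ∨ i.val + 1 < R₂[m].val := by
    intro t htj hUt
    induction t, hUt using Nat.le_induction with
    | base =>
      rw [hU₂]
      exact ⟨hUa, hUc, fun m _ h1 h2 => by omega⟩
    | succ t hUt ih =>
      obtain ⟨ih1, ih2, ih3⟩ := ih (by omega)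
      have htl : t < R₂.length := by omega
      have hasc := ascent_of_reduced h₂ htl
      -- A pair not yet inverted at time t was not inverted earlier.
      have hnot : ∀ {u v : Fin n} {s : ℕ}, u < v → s ≤ t →
          pos (wordProd (R₂.take t)) u < pos (wordProd (R₂.take t)) v →
          pos (wordProd (R₂.take s)) u < pos (wordProd (R₂.take s)) v := by
        intro u v s huv hst h
        by_contra hcon
        exact lt_asymm h (pos_lt_mono h₂ huv hst
          (lt_of_le_of_ne (not_lt.1 hcon) ((pos_injective _).ne huv.ne')))
      have hfar : R₂[t].val + 1 < i.val ∨ i.val + 1 < R₂[t].val := by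
        by_contra hcon
        obtain ⟨d, hd⟩ : ∃ d, d = wordProd (R₂.take t) (leftPos R₂[t]) := ⟨_, rfl⟩
        obtain ⟨e, he⟩ : ∃ e, e = wordProd (R₂.take t) (rightPos R₂[t]) := ⟨_, rfl⟩
        rw [← hd, ← he] at hasc
        have hde : pos (wordProd (R₂.take t)) d < pos (wordProd (R₂.take t)) e := by
          rw [pos_eq_iff.2 hd, pos_eq_iff.2 he]
          exact leftPos_lt_rightPos _
        have hde' : pos (wordProd (R₂.take (t + 1))) e < pos (wordProd (R₂.take (t + 1))) d := by
          rw [wordProd_take_succ htl, pos_mul_simpleRefl, pos_mul_simpleRefl, pos_eq_iff.2 hd,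
            pos_eq_iff.2 he, simpleRefl_leftPos, simpleRefl_rightPos]
          exact leftPos_lt_rightPos _
        have hcase : R₂[t].val = i.val ∨ R₂[t].val = i.val + 1 ∨ R₂[t].val + 1 = i.val := by omega
        rcases hcase with h | h | h
        · have h := Fin.ext h
          have h3 := exchange_unique h₂ hj htl
            (by rw [← hja, h, ← ih1, apply_pos]) (by rw [← hjc, h, ← ih2, apply_pos])
          omega
        -- The letter i + 1 would exchange c with some e > c before a and c are exchanged. In `R₁`
        -- the value c leads a and e just after `U`; in `R₂` it never does.
        · have hdc : d = c := by
            rw [hd, pos_eq_iff.1 ih2]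
            congr 1
            exact Fin.ext h
          subst hdc
          have hl : LeadsAt R₁ a d e := by
            refine ⟨U.length + 1, ?_⟩
            have := hnot hasc hUt hde
            rw [hU₂, hUc] at this
            rw [hU₁', pos_mul_simpleRefl, pos_mul_simpleRefl, pos_mul_simpleRefl, hUa, hUc,
              simpleRefl_leftPos, simpleRefl_rightPos, simpleRefl_of_ne
                ((leftPos_lt_rightPos i).trans this).ne' this.ne']
            exact ⟨leftPos_lt_rightPos i, (leftPos_lt_rightPos i).trans this⟩
          obtain ⟨s, h1, h2⟩ := (hT a d e hac hasc).1 hl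
          rcases le_or_gt s j with h3 | h3
          · have := pos_lt_mono h₂ hac h3 h1
            rw [pos_eq_iff.2 hja, pos_eq_iff.2 hjc] at this
            exact lt_asymm this (leftPos_lt_rightPos _)
          · exact lt_asymm h2 (pos_lt_mono h₂ hasc (by omega) hde')
        -- The letter i - 1 would exchange some d < a with a while a is still left of c, so a leads
        -- d and c in `R₂`. In `R₁` the value c passes a before a can pass d.
        · have hea : e = a := by
            rw [he, pos_eq_iff.1 ih1]
            congr 1
            exact Fin.ext h
          subst hea
          have hl : LeadsAt R₂ d e c := by
            refine ⟨t + 1, hde', ?_⟩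
            rw [wordProd_take_succ htl, pos_mul_simpleRefl, pos_mul_simpleRefl, ih1, ih2,
              show leftPos i = rightPos R₂[t] from Fin.ext h.symm, simpleRefl_rightPos,
              simpleRefl_of_ne] <;>
              simp [leftPos, rightPos, Fin.ext_iff, Fin.lt_def] <;> omega
          obtain ⟨s, h1, h2⟩ := (hT d e c hasc hac).2 hl
          rcases le_or_gt s U.length with h3 | h3
          · have h4 := pos_lt_mono h₁ hasc h3 h1
            have h5 := hnot hasc hUt hde
            rw [hU₁] at h4
            rw [hU₂] at h5
            exact lt_asymm h4 h5
          · refine lt_asymm h2 (pos_lt_mono h₁ hac h3 ?_)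
            rw [hU₁', pos_mul_simpleRefl, pos_mul_simpleRefl, hUa, hUc,
              simpleRefl_leftPos, simpleRefl_rightPos]
            exact leftPos_lt_rightPos i
      refine ⟨?_, ?_, fun m hm h1 h2 => ?_⟩
      · rw [wordProd_take_succ htl, pos_mul_simpleRefl, ih1, simpleRefl_of_ne] <;>
          simp [leftPos, rightPos, Fin.ext_iff] <;> omega
      · rw [wordProd_take_succ htl, pos_mul_simpleRefl, ih2, simpleRefl_of_ne] <;>
          simp [leftPos, rightPos, Fin.ext_iff] <;> omega
      · by_cases hmt : m = t
        · subst hmt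
          exact hfar
        · exact ih3 m hm h1 (by omega)
  obtain ⟨k1, -, k3⟩ := key j le_rfl hUj
  rw [pos_eq_iff.2 hja] at k1
  have hji : R₂[j] = i := by
    simpa [leftPos, Fin.ext_iff] using k1
  obtain ⟨m, rfl⟩ : ∃ m, j = U.length + m := ⟨j - U.length, by omega⟩
  subst hR₂
  have hm : m < V₂.length := by simpa using hj
  refine ⟨V₂.take m, V₂.drop (m + 1), ?_, ?_⟩
  · conv_lhs => rw [← List.take_append_drop m V₂, List.drop_eq_getElem_cons hm]
    rw [← hji]
    simp
  · intro k hk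
    obtain ⟨q, hq, rfl⟩ := List.getElem_of_mem hk
    have hq' : q < m := by
      rw [List.length_take] at hq
      omega
    have := k3 (U.length + q) (by simp; omega) (by omega) (by omega)
    simpa using this

/-- Commuting the next letter of the first word to the front of `V₂` lengthens the common prefix
and, by invariance under commutations, preserves the hypothesis. -/
theorem sameCommClass_of_leadsAt_iff {n : ℕ} {V₁ : Word n} :
    ∀ {U V₂ : Word n}, U ++ V₁ ∈ reducedWords (longest n) →
      U ++ V₂ ∈ reducedWords (longest n) →
      (∀ a b c : Fin n, a < b → b < c → (LeadsAt (U ++ V₁) a b c ↔ LeadsAt (U ++ V₂) a b c)) →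
      SameCommClass (U ++ V₁) (U ++ V₂) := by
  induction V₁ with
  | nil =>
    intro U V₂ h₁ h₂ _
    have : V₂.length = 0 := by
      have e1 := h₁.2
      have e2 := h₂.2
      rw [List.length_append] at e1 e2
      simp at e1
      omega
    rw [List.length_eq_zero_iff.1 this]
    exact Relation.ReflTransGen.refl
  | cons i V₁ ih =>
    intro U V₂ h₁ h₂ hT
    obtain ⟨P, Q, rfl, hP⟩ := far_of_leadsAt_iff h₁ h₂ hT
    have hs := sameCommClass_move_front U Q i P hP
    have h := ih (U := U ++ [i]) (V₂ := P ++ Q) (by simpa using h₁)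
      (by simpa using hs.reduced h₂) (fun a b c hab hbc => by
        simpa using (hT a b c hab hbc).trans hs.leadsAt_iff)
    have h' : SameCommClass (U ++ i :: V₁) (U ++ i :: (P ++ Q)) := by simpa using h
    exact h'.trans hs.symm

theorem tripleInv_eq_iff_sameCommClass {n : ℕ} {R₁ R₂ : Word n}
    (h₁ : R₁ ∈ reducedWords (longest n)) (h₂ : R₂ ∈ reducedWords (longest n)) :
    (∀ a b c : Fin n, a < b → b < c → tripleInv R₁ a b c = tripleInv R₂ a b c) ↔
      SameCommClass R₁ R₂ := by
  constructor
  · intro h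
    refine sameCommClass_of_leadsAt_iff (U := []) h₁ h₂ fun a b c hab hbc => ?_
    exact (tripleInv_eq_iff h₁ h₂ hab hbc).1 (h a b c hab hbc)
  · intro h a b c hab hbc
    exact (tripleInv_eq_iff h₁ h₂ hab hbc).2 h.leadsAt_iff

end BottSamelsonWords

open BottSamelsonWords
theorem mainTheorem5 (n : ℕ) :
    -- the sum of the two statistics does not depend on the word, and the constant vanishes
    (∃ C : Fin n → Fin n → Fin n → ℤ, ∀ a b c : Fin n, a < b → b < c →
      (∀ R ∈ reducedWords (longest n), Theta R a b c + tripleInv R a b c = C a b c) ∧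
        C a b c = 0) ∧
    -- equivalently, one statistic is the negative of the other
    (∀ R ∈ reducedWords (longest n), ∀ a b c : Fin n, a < b → b < c →
      Theta R a b c = -tripleInv R a b c) ∧
    -- the signed statistic recovers the commutation class
    (∀ R₁ ∈ reducedWords (longest n), ∀ R₂ ∈ reducedWords (longest n),
      (∀ a b c : Fin n, a < b → b < c → Theta R₁ a b c = Theta R₂ a b c) ↔
        SameCommClass R₁ R₂) ∧
    -- the coefficients entering the signed statistic count one-letter Demazure shortenings
    (2 ≤ n → ∀ R ∈ reducedWords (longest n), ∀ x : Equiv.Perm (Fin n),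
      secondCoeff R x =
        (Finset.card {j : Fin R.length | dem (R.eraseIdx j.val) = x} : ℤ)) := by
  refine ⟨⟨fun _ _ _ => 0, fun a b c hab hbc => ⟨fun R hR => ?_, rfl⟩⟩,
    fun R hR a b c hab hbc => Theta_eq_neg_tripleInv hR hab hbc, fun R₁ h₁ R₂ h₂ => ?_,
    fun hn R hR x => secondCoeff_eq_card hn hR x⟩
  · rw [Theta_eq_neg_tripleInv hR hab hbc, neg_add_cancel]
  · rw [← tripleInv_eq_iff_sameCommClass h₁ h₂]
    refine forall_congr' fun a => forall_congr' fun b => forall_congr' fun c =>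
      forall_congr' fun hab => forall_congr' fun hbc => ?_
    rw [Theta_eq_neg_tripleInv h₁ hab hbc, Theta_eq_neg_tripleInv h₂ hab hbc, neg_inj]
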